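/- Let $d\ge 1$ and let $J\subset\mathbb{R}^d$ be a compact set with nonempty interior. Let $(n_k)_{k\ge1}$ be integers with $n_k\ge 2$, let $(c_k)_{k\ge1}$ be real numbers with $0<c_k<1$ and $\inf_k c_k>0$, and let $(a_k)_{k\ge1}$ be nonnegative real numbers with $\sum_k a_k<\infty$. For $k\ge 0$ let $\Omega_k$ be the set of words $\sigma_1\cdots\sigma_k$ of integers with $1\le\sigma_j\le n_j$ for $1\le j\le k$ (so $\Omega_0=\{\emptyset\}$), and write $|A|$ for the diameter of $A$. Let $(J_\sigma)_{\sigma\in\bigcup_{k\ge 0}\Omega_k}$ be subsets of $\mathbb{R}^d$ with $J_\emptyset=J$ such that for all $k\ge1$ and $\sigma\in\Omega_{k-1}$: - for $1\le j\le n_k$, $J_{\sigma j}\subset J_\sigma$, the set $J_{\sigma j}$ is geometrically similar to $J_\sigma$ (that is, it is the image of $J_\sigma$ under a similarity of $\mathbb{R}^d$ with positive ratio), and $c_k(1-a_k)\le |J_{\sigma j}|/|J_\sigma|\le c_k(1+a_k)$; - $\operatorname{int}(J_{\sigma i})\cap\operatorname{int}(J_{\sigma j})=\emptyset$ for $1\le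 i<j\le n_k$. Let $E=\bigcap_{k\ge1}\bigcup_{\sigma\in\Omega_k}J_\sigma$ be the resulting Cantor-like set, and put $\delta_k=c_1\cdots c_k$. Let $0<\theta<1$. Let $\dim_L^\theta E$ denote the lower spectrum $$\dim_L^\theta E=\sup\Big\{s\ge0:\ \exists\, b,C>0\ \ \forall\, 0<R<b\ \ \forall x\in E,\quad N_{R^{1/\theta}}\big(B(x,R)\cap E\big)\ge C\Big(\frac{R}{R^{1/\theta}}\Big)^s\Big\},$$ where $B(x,R)$ is the closed ball and $N_r(A)$ is the smallest number of closed balls of radius $r$ in $\mathbb{R}^d$ that cover $A$. Then for every $k\ge1$ the maximum $$l(\theta,k)=\max\{l\in\mathbb{Z}^+:\ \delta_l\ge\delta_k^{1/\theta}\}$$ exists, and $$\dim_L^\theta E=\liminf_{k\to\infty}\frac{\log(n_{k+1}\cdots n_{l(\theta,k)})}{(1-\frac1\theta)\log\delta_k},$$ where an empty product equals $1$. -/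

import Mathlib

open Filter Topology
open scoped ENNReal NNReal

noncomputable section

namespace CantorLike

/-- The lower spectrum of a subset `F` of a metric space at the parameter `θ`: the supremum (as an
extended real number) of all `s ≥ 0` for which there are `b, C > 0` such that
`N (B(x, R) ∩ F, R ^ (1/θ)) ≥ C (R / R ^ (1/θ)) ^ s` for all `0 < R < b` and all `x ∈ F`.
Here `N (A, r)` is the least number of balls of radius `r`, centred anywhere in the ambient space,
that cover `A`; all balls are closed. -/
def lowerSpectrum {X : Type*} [PseudoMetricSpace X] (θ : ℝ) (F : Set X) : EReal :=
  sSup {t : EReal | ∃ s : ℝ, t = (s : EReal) ∧ 0 ≤ s ∧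
    ∃ b : ℝ, 0 < b ∧ ∃ C : ℝ, 0 < C ∧ ∀ R : ℝ, 0 < R → R < b → ∀ x ∈ F,
      ENNReal.ofReal (C * (R / R ^ (1 / θ)) ^ s) ≤
        (Metric.externalCoveringNumber (R ^ (1 / θ)).toNNReal
          (Metric.closedBall x R ∩ F) : ℝ≥0∞)}

/-- The set of words `σ₁ σ₂ ⋯ σ_k` of length `k` with `1 ≤ σ_j ≤ n_j` for `1 ≤ j ≤ k`
(the list entry with index `i` is the letter `σ_{i+1}`). -/
def words (n : ℕ → ℕ) (k : ℕ) : Set (List ℕ) :=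
  {σ | σ.length = k ∧ ∀ (i : ℕ) (hi : i < σ.length), 1 ≤ σ[i] ∧ σ[i] ≤ n (i + 1)}

/-- Two subsets of a metric space are geometrically similar if a bijective similarity of the space
(a map multiplying all distances by one positive constant) takes the first onto the second. -/
def GeometricallySimilar {X : Type*} [PseudoMetricSpace X] (A B : Set X) : Prop :=
  ∃ f : X ≃ᵈ X, f '' A = B

/-- The standing conditions on the sequences; only the terms with index `k ≥ 1` matter. -/
structure AdmissibleSequences (c : ℕ → ℝ) (n : ℕ → ℕ) (a : ℕ → ℝ) : Prop where
  a_nonneg : ∀ k, 1 ≤ k → 0 ≤ a k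
  a_summable : Summable a
  two_le_n : ∀ k, 1 ≤ k → 2 ≤ n k
  c_lt_one : ∀ k, 1 ≤ k → c k < 1
  c_inf_pos : ∃ m : ℝ, 0 < m ∧ ∀ k, 1 ≤ k → m ≤ c k

/-- `S σ`, for `σ` a word, is a family of sets of the kind used to build a Cantor-like set from
`J`. The `j`-th child of `S σ` is `S (σ ++ [j])`. -/
structure IsCantorLikeFamily {d : ℕ} (J : Set (EuclideanSpace ℝ (Fin d)))
    (c : ℕ → ℝ) (n : ℕ → ℕ) (a : ℕ → ℝ)
    (S : List ℕ → Set (EuclideanSpace ℝ (Fin d))) : Prop where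
  root : S [] = J
  subset : ∀ k, 1 ≤ k → ∀ σ ∈ words n (k - 1), ∀ j, 1 ≤ j → j ≤ n k → S (σ ++ [j]) ⊆ S σ
  similar : ∀ k, 1 ≤ k → ∀ σ ∈ words n (k - 1), ∀ j, 1 ≤ j → j ≤ n k →
    GeometricallySimilar (S σ) (S (σ ++ [j]))
  ratio : ∀ k, 1 ≤ k → ∀ σ ∈ words n (k - 1), ∀ j, 1 ≤ j → j ≤ n k →
    c k * (1 - a k) ≤ Metric.diam (S (σ ++ [j])) / Metric.diam (S σ) ∧
      Metric.diam (S (σ ++ [j])) / Metric.diam (S σ) ≤ c k * (1 + a k)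
  disjoint_interior : ∀ k, 1 ≤ k → ∀ σ ∈ words n (k - 1), ∀ i j, 1 ≤ i → i < j → j ≤ n k →
    interior (S (σ ++ [i])) ∩ interior (S (σ ++ [j])) = ∅

/-- The class of all Cantor-like sets associated with `J`, `(c_k)`, `(n_k)` and `(a_k)`. -/
def cantorLikeSets {d : ℕ} (J : Set (EuclideanSpace ℝ (Fin d)))
    (c : ℕ → ℝ) (n : ℕ → ℕ) (a : ℕ → ℝ) : Set (Set (EuclideanSpace ℝ (Fin d))) :=
  {E | ∃ S : List ℕ → Set (EuclideanSpace ℝ (Fin d)), IsCantorLikeFamily J c n a S ∧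
    E = ⋂ k : ℕ, ⋂ _ : 1 ≤ k, ⋃ σ ∈ words n k, S σ}

/-- `δ_k = c₁ ⋯ c_k`, with `δ₀ = 1`. -/
def delta (c : ℕ → ℝ) (k : ℕ) : ℝ := ∏ i ∈ Finset.Icc 1 k, c i

/-- The set of positive integers `l` with `δ_l ≥ δ_k ^ (1/θ)`. -/
def levelSet (c : ℕ → ℝ) (θ : ℝ) (k : ℕ) : Set ℕ :=
  {l | 1 ≤ l ∧ delta c k ^ (1 / θ) ≤ delta c l}

/-- `l(θ, k)`, the largest positive integer `l` with `δ_l ≥ δ_k ^ (1/θ)`. -/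
def level (c : ℕ → ℝ) (θ : ℝ) (k : ℕ) : ℕ := sSup (levelSet c θ k)

end CantorLike

end

namespace CantorLike

open Metric MeasureTheory

/-! ### Words and their descendants -/

/-! Since `∑ a_k` converges, the errors `1 ± a_k` multiply up to bounded factors, so level-`k` sets
have diameter comparable to `δ_k`. Being similar to `J`, each contains a ball of comparable radius,
and their interiors are disjoint; comparing volumes bounds how many meet a given ball
(`exists_packingBound`). Packing and `n_k ≥ 2` also force `δ_k → 0` (`tendsto_delta`), which makes
`l(θ,k)` exist.

A level-`k` set has `n_{k+1}⋯n_l` descendants at level `l = l(θ,k)`, whose size is comparable to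
`δ_k^(1/θ)` because `inf c_k > 0`. Hence the covering number of `B(x,R) ∩ E` at scale `R^(1/θ)` is
at most a constant times this product when `R = δ_k` (`exists_externalCoveringNumber_le`), and for
any small `R` it is at least a constant times such a product with `δ_k` comparable to `R`
(`exists_prod_le_externalCoveringNumber`). Constants do not depend on `x`. On taking logarithms they
vanish in the limit, because `log δ_k → -∞`. -/

theorem words_zero (n : ℕ → ℕ) : words n 0 = {[]} := by
  ext σ
  simp only [words, Set.mem_ofPred_eq, Set.mem_singleton_iff, List.length_eq_zero_iff]
  constructor
  · exact fun h => h.1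
  · rintro rfl
    simp

theorem mem_words_succ {n : ℕ → ℕ} {k : ℕ} {τ : List ℕ} :
    τ ∈ words n (k + 1) ↔ ∃ σ ∈ words n k, ∃ j, 1 ≤ j ∧ j ≤ n (k + 1) ∧ τ = σ ++ [j] := by
  constructor
  · rintro ⟨hl, h⟩
    rcases List.eq_nil_or_concat' τ with rfl | ⟨σ, j, rfl⟩
    · simp at hl
    · simp only [List.length_append, List.length_cons, List.length_nil, zero_add,
        Nat.add_right_cancel_iff] at hl
      refine ⟨σ, ⟨hl, fun i hi => ?_⟩, j, ?_⟩
      · have := h i (by simp; omega)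
        rwa [List.getElem_append_left hi] at this
      · have := h k (by simp [hl])
        rw [List.getElem_append_right (by omega)] at this
        simpa using this
  · rintro ⟨σ, ⟨hl, h⟩, j, h1, h2, rfl⟩
    refine ⟨by simp [hl], fun i hi => ?_⟩
    by_cases hik : i < σ.length
    · rw [List.getElem_append_left hik]
      exact h i hik
    · have : i = k := by simp at hi; omega
      subst this
      rw [List.getElem_append_right (by omega)]
      simpa using ⟨h1, h2⟩

/-- The words of length `k + q` that extend a word `σ` of length `k`. -/
def descendants (n : ℕ → ℕ) (k : ℕ) (σ : List ℕ) : ℕ → Finset (List ℕ)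
  | 0 => {σ}
  | q + 1 => (descendants n k σ q ×ˢ Finset.Icc 1 (n (k + q + 1))).image fun p => p.1 ++ [p.2]

theorem mem_descendants_succ {n : ℕ → ℕ} {k q : ℕ} {σ τ : List ℕ} :
    τ ∈ descendants n k σ (q + 1) ↔
      ∃ ρ ∈ descendants n k σ q, ∃ j, 1 ≤ j ∧ j ≤ n (k + q + 1) ∧ τ = ρ ++ [j] := by
  simp only [descendants, Finset.mem_image, Finset.mem_product, Finset.mem_Icc, Prod.exists]
  constructor
  · rintro ⟨ρ, j, ⟨h, h1, h2⟩, rfl⟩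
    exact ⟨ρ, h, j, h1, h2, rfl⟩
  · rintro ⟨ρ, h, j, h1, h2, rfl⟩
    exact ⟨ρ, j, ⟨h, h1, h2⟩, rfl⟩

theorem card_descendants (n : ℕ → ℕ) (k : ℕ) (σ : List ℕ) (q : ℕ) :
    (descendants n k σ q).card = ∏ i ∈ Finset.Icc (k + 1) (k + q), n i := by
  induction q with
  | zero => simp [descendants]
  | succ q ih =>
    rw [descendants, Finset.card_image_of_injective, Finset.card_product, ih, Nat.card_Icc,
      ← add_assoc, Finset.prod_Icc_succ_top (by omega), Nat.add_sub_cancel]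
    rintro ⟨a, b⟩ ⟨a', b'⟩ h
    have := List.append_inj' h rfl
    simp_all

theorem mem_words_of_mem_descendants {n : ℕ → ℕ} {k : ℕ} {σ : List ℕ} (hσ : σ ∈ words n k)
    {q : ℕ} {τ : List ℕ} (hτ : τ ∈ descendants n k σ q) : τ ∈ words n (k + q) := by
  induction q generalizing τ with
  | zero => simpa [descendants] using (Finset.mem_singleton.1 hτ) ▸ hσ
  | succ q ih =>
    obtain ⟨ρ, hρ, j, h1, h2, rfl⟩ := mem_descendants_succ.1 hτ
    exact mem_words_succ.2 ⟨ρ, ih hρ, j, h1, h2, rfl⟩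

theorem exists_mem_descendants {n : ℕ → ℕ} {k q : ℕ} {τ : List ℕ} (hτ : τ ∈ words n (k + q)) :
    ∃ σ ∈ words n k, τ ∈ descendants n k σ q := by
  induction q generalizing τ with
  | zero => exact ⟨τ, hτ, by simp [descendants]⟩
  | succ q ih =>
    obtain ⟨ρ, hρ, j, h1, h2, rfl⟩ := mem_words_succ.1 hτ
    obtain ⟨σ, hσ, h⟩ := ih hρ
    exact ⟨σ, hσ, mem_descendants_succ.2 ⟨ρ, h, j, h1, h2, rfl⟩⟩

theorem coe_descendants_nil (n : ℕ → ℕ) (k : ℕ) :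
    (descendants n 0 [] k : Set (List ℕ)) = words n k := by
  ext τ
  constructor
  · intro h
    have := mem_words_of_mem_descendants (n := n) (k := 0) (σ := []) (by simp [words_zero]) h
    rwa [zero_add] at this
  · intro h
    rw [← zero_add k] at h
    obtain ⟨σ, hσ, hτ⟩ := exists_mem_descendants h
    rw [words_zero, Set.mem_singleton_iff] at hσ
    exact hσ ▸ hτ

theorem words_finite (n : ℕ → ℕ) (k : ℕ) : (words n k).Finite :=
  coe_descendants_nil n k ▸ Finset.finite_toSet _

/-! ### The sequence `δ` -/

theorem delta_zero (c : ℕ → ℝ) : delta c 0 = 1 := by simp [delta]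

theorem delta_succ (c : ℕ → ℝ) (k : ℕ) : delta c (k + 1) = delta c k * c (k + 1) := by
  rw [delta, Finset.prod_Icc_succ_top (by omega), delta]

namespace AdmissibleSequences

variable {c : ℕ → ℝ} {n : ℕ → ℕ} {a : ℕ → ℝ}

theorem c_pos (h : AdmissibleSequences c n a) {k : ℕ} (hk : 1 ≤ k) : 0 < c k := by
  obtain ⟨m, hm, hc⟩ := h.c_inf_pos
  exact hm.trans_le (hc k hk)

theorem delta_pos (h : AdmissibleSequences c n a) (k : ℕ) : 0 < delta c k :=
  Finset.prod_pos fun _ hi => h.c_pos (Finset.mem_Icc.1 hi).1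

theorem delta_strictAnti (h : AdmissibleSequences c n a) : StrictAnti (delta c) := by
  refine strictAnti_nat_of_succ_lt fun k => ?_
  rw [delta_succ]
  exact mul_lt_of_lt_one_right (h.delta_pos k) (h.c_lt_one _ (by omega))

end AdmissibleSequences

/-! ### Packing bound -/

theorem card_le_of_disjoint_balls {d : ℕ} {ι : Type*} (F : Finset ι)
    (y : ι → EuclideanSpace ℝ (Fin d)) (x : EuclideanSpace ℝ (Fin d)) {r R : ℝ} (hr : 0 < r)
    (hR : 0 ≤ R) (hsub : ∀ i ∈ F, ball (y i) r ⊆ closedBall x R)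
    (hdisj : (F : Set ι).PairwiseDisjoint fun i => ball (y i) r) :
    (F.card : ℝ) ≤ (R / r) ^ d := by
  have hv : volume (⋃ i ∈ F, ball (y i) r) ≤ volume (closedBall x R) :=
    measure_mono (Set.iUnion₂_subset hsub)
  rw [measure_biUnion_finset hdisj fun _ _ => measurableSet_ball,
    Measure.addHaar_closedBall _ _ hR] at hv
  simp_rw [Measure.addHaar_ball_of_pos volume _ hr] at hv
  rw [Finset.sum_const, nsmul_eq_mul, ← mul_assoc,
    ENNReal.mul_le_mul_iff_left (measure_ball_pos _ _ one_pos).ne' measure_ball_lt_top.ne,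
    finrank_euclideanSpace_fin, ← ENNReal.ofReal_natCast,
    ← ENNReal.ofReal_mul (by positivity), ENNReal.ofReal_le_ofReal_iff (by positivity)] at hv
  rw [div_pow, le_div_iff₀ (by positivity)]
  exact hv

/-! ### Geometry of the basic sets -/

/-- The basic sets of level `k` have diameter at most `A * delta c k`, and at most
`(A * (R / delta c k + 1)) ^ d` of them meet a given ball of radius `R`. -/
structure PackingBound {d : ℕ} (c : ℕ → ℝ) (n : ℕ → ℕ)
    (S : List ℕ → Set (EuclideanSpace ℝ (Fin d))) (A : ℝ) : Prop where
  one_le : 1 ≤ A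
  diam_le : ∀ k, ∀ σ ∈ words n k, diam (S σ) ≤ A * delta c k
  card_le : ∀ (k : ℕ) (x : EuclideanSpace ℝ (Fin d)) (R : ℝ), 0 ≤ R → ∀ F : Finset (List ℕ),
    (∀ σ ∈ F, σ ∈ words n k ∧ (S σ ∩ closedBall x R).Nonempty) →
    (F.card : ℝ) ≤ (A * (R / delta c k + 1)) ^ d

namespace IsCantorLikeFamily

variable {d : ℕ} {J : Set (EuclideanSpace ℝ (Fin d))} {c : ℕ → ℝ} {n : ℕ → ℕ} {a : ℕ → ℝ}
  {S : List ℕ → Set (EuclideanSpace ℝ (Fin d))}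

theorem exists_dilation (hS : IsCantorLikeFamily J c n a S) {k : ℕ} {σ : List ℕ}
    (hσ : σ ∈ words n k) :
    ∃ f : EuclideanSpace ℝ (Fin d) ≃ᵈ EuclideanSpace ℝ (Fin d), f '' J = S σ := by
  induction k generalizing σ with
  | zero =>
    rw [words_zero, Set.mem_singleton_iff] at hσ
    exact ⟨DilationEquiv.refl _, by simp [hσ, hS.root]⟩
  | succ k ih =>
    obtain ⟨ρ, hρ, j, h1, h2, rfl⟩ := mem_words_succ.1 hσ
    obtain ⟨f, hf⟩ := ih hρ
    obtain ⟨g, hg⟩ := hS.similar (k + 1) (by omega) ρ hρ j h1 h2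
    exact ⟨f.trans g, by rw [← hg, ← hf, Set.image_image]; rfl⟩

theorem subset_of_mem_descendants (hS : IsCantorLikeFamily J c n a S) {k : ℕ} {σ : List ℕ}
    (hσ : σ ∈ words n k) {q : ℕ} {τ : List ℕ} (hτ : τ ∈ descendants n k σ q) : S τ ⊆ S σ := by
  induction q generalizing τ with
  | zero => rw [Finset.mem_singleton.1 hτ]
  | succ q ih =>
    obtain ⟨ρ, hρ, j, h1, h2, rfl⟩ := mem_descendants_succ.1 hτ
    exact (hS.subset (k + q + 1) (by omega) ρ (mem_words_of_mem_descendants hσ hρ) j h1 h2).trans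
      (ih hρ)

theorem disjoint_interior_of_ne (hS : IsCantorLikeFamily J c n a S) {k : ℕ} {σ τ : List ℕ}
    (hσ : σ ∈ words n k) (hτ : τ ∈ words n k) (hne : σ ≠ τ) :
    Disjoint (interior (S σ)) (interior (S τ)) := by
  induction k generalizing σ τ with
  | zero =>
    rw [words_zero, Set.mem_singleton_iff] at hσ hτ
    exact absurd (hσ.trans hτ.symm) hne
  | succ k ih =>
    obtain ⟨σ, hσ', i, hi1, hi2, rfl⟩ := mem_words_succ.1 hσ
    obtain ⟨τ, hτ', j, hj1, hj2, rfl⟩ := mem_words_succ.1 hτ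
    by_cases h : σ = τ
    · subst h
      rcases lt_trichotomy i j with hij | rfl | hij
      · exact Set.disjoint_iff_inter_eq_empty.2
          (hS.disjoint_interior (k + 1) (by omega) σ hσ' i j hi1 hij hj2)
      · exact absurd rfl hne
      · exact (Set.disjoint_iff_inter_eq_empty.2
          (hS.disjoint_interior (k + 1) (by omega) σ hσ' j i hj1 hij hi2)).symm
    · exact (ih hσ' hτ' h).mono
        (interior_mono (hS.subset (k + 1) (by omega) σ hσ' i hi1 hi2))
        (interior_mono (hS.subset (k + 1) (by omega) τ hτ' j hj1 hj2))

theorem isCompact (hS : IsCantorLikeFamily J c n a S) (hJ : IsCompact J) {k : ℕ} {σ : List ℕ}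
    (hσ : σ ∈ words n k) : IsCompact (S σ) := by
  obtain ⟨f, hf⟩ := hS.exists_dilation hσ
  exact hf ▸ hJ.image f.toHomeomorph.continuous

theorem nonempty (hS : IsCantorLikeFamily J c n a S) (hJ : J.Nonempty) {k : ℕ} {σ : List ℕ}
    (hσ : σ ∈ words n k) : (S σ).Nonempty := by
  obtain ⟨f, hf⟩ := hS.exists_dilation hσ
  exact hf ▸ hJ.image f

/-- Choosing the first child forever gives a decreasing sequence of nonempty compact sets, which has
a common point. -/
theorem exists_mem_inter (hS : IsCantorLikeFamily J c n a S) (hn : ∀ k, 1 ≤ k → 1 ≤ n k)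
    (hJ : IsCompact J) (hJne : J.Nonempty) {k : ℕ} {σ : List ℕ} (hσ : σ ∈ words n k) :
    (S σ ∩ ⋂ k : ℕ, ⋂ _ : 1 ≤ k, ⋃ σ ∈ words n k, S σ).Nonempty := by
  have hw : ∀ q, σ ++ List.replicate q 1 ∈ words n (k + q) := fun q => by
    induction q with
    | zero => simpa using hσ
    | succ q ih =>
      refine mem_words_succ.2 ⟨_, ih, 1, le_rfl, hn _ (by omega), ?_⟩
      rw [List.replicate_succ', List.append_assoc]
  obtain ⟨y, hy⟩ := IsCompact.nonempty_iInter_of_sequence_nonempty_isCompact_isClosed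
    (fun q => S (σ ++ List.replicate q 1))
    (fun q => by
      have := hS.subset (k + q + 1) (by omega) _ (hw q) 1 le_rfl (hn _ (by omega))
      rwa [List.append_assoc, ← List.replicate_succ'] at this)
    (fun q => hS.nonempty hJne (hw q)) (hS.isCompact hJ (hw 0))
    (fun q => (hS.isCompact hJ (hw q)).isClosed)
  rw [Set.mem_iInter] at hy
  refine ⟨y, by simpa using hy 0, ?_⟩
  simp only [Set.mem_iInter, Set.mem_iUnion]
  intro i _
  -- The word reached at level `k + i` is read as a descendant of its prefix of length `i`.
  obtain ⟨q, hq⟩ : ∃ q, k + i = i + q ∧ q = k := ⟨k, by omega, rfl⟩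
  have h1 := hw i
  rw [hq.1] at h1
  obtain ⟨ρ, hρ, h2⟩ := exists_mem_descendants h1
  exact ⟨ρ, hρ, hS.subset_of_mem_descendants hρ h2 (hy i)⟩

theorem diam_pos (hd : 1 ≤ d) (hJ : Bornology.IsBounded J) (hJint : (interior J).Nonempty) :
    0 < diam J := by
  have : Nonempty (Fin d) := ⟨⟨0, hd⟩⟩
  obtain ⟨x, hx⟩ := hJint
  obtain ⟨r, hr, hsub⟩ := Metric.isOpen_iff.1 isOpen_interior x hx
  obtain ⟨v, hv⟩ := exists_ne (0 : EuclideanSpace ℝ (Fin d))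
  by_contra h
  have h0 : diam J = 0 := le_antisymm (not_lt.1 h) diam_nonneg
  have hv' : 0 < ‖v‖ := norm_pos_iff.2 hv
  have hy : x + (r / 2 / ‖v‖) • v ∈ J := interior_subset <| hsub <| by
    rw [mem_ball, dist_self_add_left, norm_smul, Real.norm_of_nonneg (by positivity),
      div_mul_cancel₀ _ hv'.ne']
    linarith
  have hdist := dist_le_diam_of_mem hJ hy (interior_subset hx)
  rw [h0, dist_self_add_left, norm_smul, Real.norm_of_nonneg (by positivity),
    div_mul_cancel₀ _ hv'.ne'] at hdist
  linarith

theorem diam_word_pos (hS : IsCantorLikeFamily J c n a S) (hJ : 0 < diam J) {k : ℕ}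
    {σ : List ℕ} (hσ : σ ∈ words n k) : 0 < diam (S σ) := by
  obtain ⟨f, hf⟩ := hS.exists_dilation hσ
  rw [← hf, Dilation.diam_image]
  exact mul_pos (NNReal.coe_pos.2 (Dilation.ratio_pos f)) hJ

/-- Similarities preserve the ratio of an inscribed ball's radius to the diameter, so a ball in `J`
serves all words. -/
theorem exists_ball_subset (hS : IsCantorLikeFamily J c n a S) (hJ : 0 < diam J)
    (hJint : (interior J).Nonempty) :
    ∃ ρ : ℝ, 0 < ρ ∧ ∀ k, ∀ σ ∈ words n k, ∃ y, ball y (ρ * diam (S σ)) ⊆ S σ := by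
  obtain ⟨x, hx⟩ := hJint
  obtain ⟨r, hr, hsub⟩ := Metric.isOpen_iff.1 isOpen_interior x hx
  refine ⟨r / diam J, by positivity, fun k σ hσ => ?_⟩
  obtain ⟨f, hf⟩ := hS.exists_dilation hσ
  refine ⟨f x, fun z hz => ?_⟩
  have hratio : (0 : ℝ) < Dilation.ratio f := NNReal.coe_pos.2 (Dilation.ratio_pos f)
  rw [← hf, Dilation.diam_image, mem_ball] at hz
  rw [← hf]
  refine ⟨f.symm z, interior_subset (hsub ?_), f.apply_symm_apply z⟩
  rw [← f.apply_symm_apply z, Dilation.dist_eq] at hz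
  rw [mem_ball]
  have : r / diam J * (Dilation.ratio f * diam J) = Dilation.ratio f * r := by
    field_simp
  rw [this] at hz
  exact lt_of_mul_lt_mul_left hz hratio.le

theorem exists_diam_le (hS : IsCantorLikeFamily J c n a S) (hseq : AdmissibleSequences c n a)
    (hJ : 0 < diam J) :
    ∃ A : ℝ, 0 < A ∧ ∀ k, ∀ σ ∈ words n k, diam (S σ) ≤ A * delta c k := by
  have hsum : ∀ k, ∀ σ ∈ words n k,
      diam (S σ) ≤ diam J * Real.exp (∑ i ∈ Finset.Icc 1 k, a i) * delta c k := by
    intro k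
    induction k with
    | zero =>
      intro σ hσ
      rw [words_zero, Set.mem_singleton_iff] at hσ
      simp [hσ, hS.root, delta_zero]
    | succ k ih =>
      intro σ hσ
      obtain ⟨ρ, hρ, j, h1, h2, rfl⟩ := mem_words_succ.1 hσ
      have hr := (hS.ratio (k + 1) (by omega) ρ hρ j h1 h2).2
      rw [div_le_iff₀ (hS.diam_word_pos hJ hρ)] at hr
      have hc := hseq.c_pos (k := k + 1) (by omega)
      rw [Finset.sum_Icc_succ_top (by omega), Real.exp_add, delta_succ]
      calc _ ≤ _ := hr
        _ ≤ c (k + 1) * Real.exp (a (k + 1)) *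
            (diam J * Real.exp (∑ i ∈ Finset.Icc 1 k, a i) * delta c k) := by
          gcongr
          · rw [add_comm]
            exact Real.add_one_le_exp _
          · exact ih ρ hρ
        _ = _ := by ring
  refine ⟨diam J * Real.exp (∑' i, |a i|), by positivity, fun k σ hσ => (hsum k σ hσ).trans ?_⟩
  have := hseq.delta_pos k
  gcongr
  exact (Finset.sum_le_sum fun i _ => le_abs_self _).trans
    (hseq.a_summable.abs.sum_le_tsum _ fun _ _ => abs_nonneg _)

/-- The lower ratio bound is useless while `1 - a k ≤ 0`. This can occur only at finitely many
levels, hence finitely many words, which a maximum absorbs. -/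
theorem exists_le_diam (hS : IsCantorLikeFamily J c n a S) (hseq : AdmissibleSequences c n a)
    (hJ : 0 < diam J) :
    ∃ A : ℝ, 0 < A ∧ ∀ k, ∀ σ ∈ words n k, delta c k ≤ A * diam (S σ) := by
  obtain ⟨K, hK⟩ : ∃ K, ∀ k ≥ K, a k ≤ 1 / 2 :=
    eventually_atTop.1 (hseq.a_summable.tendsto_atTop_zero.eventually_le_const (by norm_num))
  obtain ⟨B, hB⟩ : ∃ B : ℝ, ∀ k ≤ K, ∀ σ ∈ words n k, delta c k / diam (S σ) ≤ B := by
    have hfin : ((fun p : ℕ × List ℕ => delta c p.1 / diam (S p.2)) ''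
        (⋃ k ∈ Set.Iic K, (fun σ => (k, σ)) '' words n k)).Finite :=
      ((Set.finite_Iic K).biUnion fun k _ => (words_finite n k).image _).image _
    obtain ⟨B, hB⟩ := hfin.bddAbove
    exact ⟨B, fun k hk σ hσ => hB ⟨(k, σ), Set.mem_biUnion hk ⟨σ, hσ, rfl⟩, rfl⟩⟩
  set B' := max B 1
  have hB' : 0 < B' := lt_of_lt_of_le one_pos (le_max_right _ _)
  have key : ∀ k, ∀ σ ∈ words n k,
      delta c k ≤ B' * Real.exp (∑ i ∈ Finset.Icc 1 k, 2 * |a i|) * diam (S σ) := by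
    intro k
    induction k with
    | zero =>
      intro σ hσ
      have h := (div_le_iff₀ (hS.diam_word_pos hJ hσ)).1 ((hB 0 (by omega) σ hσ).trans
        (le_max_left B 1))
      simpa using h
    | succ k ih =>
      intro σ hσ
      have hpos := hS.diam_word_pos hJ hσ
      by_cases hk : k + 1 ≤ K
      · refine ((div_le_iff₀ hpos).1 ((hB (k + 1) hk σ hσ).trans (le_max_left B 1))).trans ?_
        gcongr
        exact le_mul_of_one_le_right hB'.le (Real.one_le_exp (Finset.sum_nonneg fun _ _ => by
          positivity))
      · obtain ⟨ρ, hρ, j, h1, h2, rfl⟩ := mem_words_succ.1 hσ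
        have hr := (hS.ratio (k + 1) (by omega) ρ hρ j h1 h2).1
        have hρpos := hS.diam_word_pos hJ hρ
        rw [le_div_iff₀ hρpos] at hr
        have hc := hseq.c_pos (k := k + 1) (by omega)
        have ha0 := hseq.a_nonneg (k + 1) (by omega)
        have ha := hK (k + 1) (by omega)
        -- For `0 ≤ t ≤ 1/2`, `(1 + 2t)(1 - t) = 1 + t(1 - 2t) ≥ 1`.
        have hexp : 1 ≤ Real.exp (2 * |a (k + 1)|) * (1 - a (k + 1)) := by
          rw [abs_of_nonneg ha0]
          have := Real.add_one_le_exp (2 * a (k + 1))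
          nlinarith
        rw [Finset.sum_Icc_succ_top (by omega), Real.exp_add, delta_succ]
        calc delta c k * c (k + 1)
            ≤ (B' * Real.exp (∑ i ∈ Finset.Icc 1 k, 2 * |a i|) * diam (S ρ)) * c (k + 1) * 1 := by
              rw [mul_one]
              gcongr
              exact ih ρ hρ
          _ ≤ (B' * Real.exp (∑ i ∈ Finset.Icc 1 k, 2 * |a i|) * diam (S ρ)) * c (k + 1) *
              (Real.exp (2 * |a (k + 1)|) * (1 - a (k + 1))) := by gcongr
          _ = B' * (Real.exp (∑ i ∈ Finset.Icc 1 k, 2 * |a i|) * Real.exp (2 * |a (k + 1)|)) *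
              (c (k + 1) * (1 - a (k + 1)) * diam (S ρ)) := by ring
          _ ≤ _ := by gcongr
  refine ⟨B' * Real.exp (∑' i, 2 * |a i|), by positivity, fun k σ hσ => (key k σ hσ).trans ?_⟩
  gcongr
  exact (hseq.a_summable.abs.mul_left 2).sum_le_tsum _ fun _ _ => by positivity

theorem exists_packingBound (hS : IsCantorLikeFamily J c n a S) (hseq : AdmissibleSequences c n a)
    (hJbdd : IsCompact J) (hJ : 0 < diam J) (hJint : (interior J).Nonempty) :
    ∃ A : ℝ, PackingBound c n S A := by
  obtain ⟨A₁, hA₁, h₁⟩ := hS.exists_diam_le hseq hJ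
  obtain ⟨A₂, hA₂, h₂⟩ := hS.exists_le_diam hseq hJ
  obtain ⟨ρ, hρ, h₃⟩ := hS.exists_ball_subset hJ hJint
  set A := max (max 1 A₁) (max (A₂ / ρ) (A₁ * A₂ / ρ))
  have hA1 : 1 ≤ A := (le_max_left _ _).trans (le_max_left _ _)
  refine ⟨A, hA1, fun k σ hσ => (h₁ k σ hσ).trans ?_, fun k x R hR F hF => ?_⟩
  · have := hseq.delta_pos k
    gcongr
    exact (le_max_right _ _).trans (le_max_left _ _)
  · have hδ := hseq.delta_pos k
    choose! y hy using fun σ (hσ : σ ∈ F) => h₃ k σ (hF σ hσ).1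
    have hsub : ∀ σ ∈ F, ball (y σ) (ρ * (delta c k / A₂)) ⊆ S σ := fun σ hσ => by
      refine (ball_subset_ball ?_).trans (hy σ hσ)
      gcongr
      rw [div_le_iff₀ hA₂, mul_comm]
      exact h₂ k σ (hF σ hσ).1
    refine (card_le_of_disjoint_balls F y x (r := ρ * (delta c k / A₂))
      (R := R + A₁ * delta c k) (by positivity) (by positivity) (fun σ hσ => ?_)
      fun σ hσ τ hτ hne => ?_).trans ?_
    · refine (hsub σ hσ).trans fun z hz => ?_
      obtain ⟨w, hw, hwx⟩ := (hF σ hσ).2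
      rw [mem_closedBall] at hwx ⊢
      have := dist_le_diam_of_mem (hS.isCompact hJbdd (hF σ hσ).1).isBounded hz hw
      have := h₁ k σ (hF σ hσ).1
      have := dist_triangle z w x
      linarith
    · exact (hS.disjoint_interior_of_ne (hF σ hσ).1 (hF τ hτ).1 hne).mono
        (interior_maximal (hsub σ hσ) isOpen_ball) (interior_maximal (hsub τ hτ) isOpen_ball)
    · gcongr
      have e : (R + A₁ * delta c k) / (ρ * (delta c k / A₂)) =
          A₂ / ρ * (R / delta c k) + A₁ * A₂ / ρ := by
        field_simp
      rw [e, mul_add, mul_one]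
      gcongr
      · exact (le_max_left _ _).trans (le_max_right _ _)
      · exact (le_max_right _ _).trans (le_max_right _ _)

end IsCantorLikeFamily

/-! ### Covering numbers of pieces of the Cantor-like set -/

theorem ofReal_le_externalCoveringNumber {X : Type*} [PseudoMetricSpace X] {B : Set X} {ε : ℝ≥0}
    {u : ℝ} (h : ∀ C : Finset X, B ⊆ ⋃ y ∈ C, closedBall y ε → u ≤ C.card) :
    ENNReal.ofReal u ≤ (externalCoveringNumber ε B : ℝ≥0∞) := by
  have h1 : ((⌈u⌉₊ : ℕ) : ℕ∞) ≤ externalCoveringNumber ε B := by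
    refine le_iInf₂ fun C hC => ?_
    rcases C.finite_or_infinite with hfin | hinf
    · lift C to Finset X using hfin
      rw [Set.encard_coe_eq_coe_finsetCard]
      exact_mod_cast Nat.ceil_le.2 (h C (by simpa using isCover_iff_subset_iUnion_closedBall.1 hC))
    · simp [hinf.encard_eq]
  calc ENNReal.ofReal u ≤ ENNReal.ofReal (⌈u⌉₊ : ℕ) := ENNReal.ofReal_le_ofReal (Nat.le_ceil u)
    _ = (((⌈u⌉₊ : ℕ) : ℕ∞) : ℝ≥0∞) := by simp
    _ ≤ _ := by exact_mod_cast h1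

namespace IsCantorLikeFamily

variable {d : ℕ} {J : Set (EuclideanSpace ℝ (Fin d))} {c : ℕ → ℝ} {n : ℕ → ℕ} {a : ℕ → ℝ}
  {S : List ℕ → Set (EuclideanSpace ℝ (Fin d))} {A : ℝ}

theorem subset_closedBall (hS : IsCantorLikeFamily J c n a S) (hJ : IsCompact J)
    (hA : PackingBound c n S A) {k : ℕ} {σ : List ℕ} (hσ : σ ∈ words n k)
    {x : EuclideanSpace ℝ (Fin d)} (hx : x ∈ S σ) : S σ ⊆ closedBall x (A * delta c k) :=
  fun _ hz => mem_closedBall.2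
    ((dist_le_diam_of_mem (hS.isCompact hJ hσ).isBounded hz hx).trans (hA.diam_le k σ hσ))

/-- All descendants of one level-`i` set lie in a ball of radius `A * delta c i`, so packing bounds
their number. -/
theorem prod_le (hS : IsCantorLikeFamily J c n a S) (hseq : AdmissibleSequences c n a)
    (hJ : IsCompact J) (hJne : J.Nonempty) (hA : PackingBound c n S A) (i q : ℕ) :
    ((∏ j ∈ Finset.Icc (i + 1) (i + q), n j : ℕ) : ℝ) ≤
      (A * (A * delta c i / delta c (i + q) + 1)) ^ d := by
  have hσ : List.replicate i 1 ∈ words n i := by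
    refine ⟨List.length_replicate, fun j hj => ?_⟩
    have := hseq.two_le_n (j + 1) (by omega)
    simp
    omega
  obtain ⟨x, hx⟩ := hS.nonempty hJne hσ
  rw [← card_descendants n i (List.replicate i 1) q]
  have := hA.one_le
  have := hseq.delta_pos i
  refine hA.card_le (i + q) x _ (by positivity) _ fun τ hτ => ?_
  have hτw := mem_words_of_mem_descendants hσ hτ
  refine ⟨hτw, ?_⟩
  rw [Set.inter_eq_left.2 ((hS.subset_of_mem_descendants hσ hτ).trans
    (hS.subset_closedBall hJ hA hσ hx))]
  exact hS.nonempty hJne hτw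

/-- Not automatic, since `c k` may tend to `1`. If `δ` stayed above `ε`, at least `2 ^ N` sets of
level `N` would have to fit within a packing bound independent of `N`. -/
theorem tendsto_delta (hS : IsCantorLikeFamily J c n a S) (hseq : AdmissibleSequences c n a)
    (hJ : IsCompact J) (hJne : J.Nonempty) (hA : PackingBound c n S A) :
    Tendsto (delta c) atTop (𝓝 0) := by
  have hA1 := hA.one_le
  rw [Metric.tendsto_atTop]
  intro ε hε
  obtain ⟨N, hN⟩ : ∃ N, delta c N < ε := by
    by_contra! h
    obtain ⟨N, hN⟩ := pow_unbounded_of_one_lt ((A * (A / ε + 1)) ^ d) (one_lt_two (α := ℝ))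
    have h1 := hS.prod_le hseq hJ hJne hA 0 N
    have h2 : (2 : ℝ) ^ N ≤ ((∏ j ∈ Finset.Icc (0 + 1) (0 + N), n j : ℕ) : ℝ) := by
      have := Finset.prod_le_prod (s := Finset.Icc (0 + 1) (0 + N)) (f := fun _ => 2) (g := n)
        (by simp) fun j hj => hseq.two_le_n j (by simp at hj; omega)
      simp only [Finset.prod_const, Nat.card_Icc, zero_add, Nat.add_sub_cancel] at this ⊢
      exact_mod_cast this
    rw [delta_zero, mul_one] at h1
    have h3 : (A * (A / delta c N + 1)) ^ d ≤ (A * (A / ε + 1)) ^ d := by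
      have := h N
      have := hseq.delta_pos N
      gcongr
    simp only [zero_add] at h1 h2
    linarith
  refine ⟨N, fun k hk => ?_⟩
  rw [Real.dist_0_eq_abs, abs_of_pos (hseq.delta_pos k)]
  exact (hseq.delta_strictAnti.antitone hk).trans_lt hN

end IsCantorLikeFamily

/-! ### Comparing scales with the sequence `δ` -/

namespace AdmissibleSequences

variable {c : ℕ → ℝ} {n : ℕ → ℕ} {a : ℕ → ℝ} {θ : ℝ}

/-- The first `j` with `delta c j ≤ r` works: the last step shrinks by a factor at least `m`. -/
theorem exists_delta_between (hseq : AdmissibleSequences c n a)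
    (hδ : Tendsto (delta c) atTop (𝓝 0)) {m : ℝ} (hm : ∀ k, 1 ≤ k → m ≤ c k) {r : ℝ}
    (hr : 0 < r) (hr1 : r ≤ 1) : ∃ j, delta c j ≤ r ∧ m * r ≤ delta c j := by
  have hex : ∃ j, delta c j ≤ r := (hδ.eventually_le_const hr).exists
  classical
  refine ⟨Nat.find hex, Nat.find_spec hex, ?_⟩
  rcases h : Nat.find hex with _ | j
  · rw [delta_zero]
    have := (hm 1 le_rfl).trans_lt (hseq.c_lt_one 1 le_rfl)
    nlinarith
  · have h1 : r < delta c j := not_le.1 (Nat.find_min hex (by omega))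
    rw [delta_succ, mul_comm (delta c j)]
    exact mul_le_mul (hm (j + 1) (by omega)) h1.le hr.le (hseq.c_pos (by omega)).le

theorem delta_lt_one (hseq : AdmissibleSequences c n a) {k : ℕ} (hk : 1 ≤ k) : delta c k < 1 :=
  delta_zero c ▸ hseq.delta_strictAnti hk

theorem self_mem_levelSet (hseq : AdmissibleSequences c n a) (hθ0 : 0 < θ) (hθ1 : θ < 1) {k : ℕ}
    (hk : 1 ≤ k) : k ∈ levelSet c θ k := by
  refine ⟨hk, ?_⟩
  conv_rhs => rw [← Real.rpow_one (delta c k)]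
  exact Real.rpow_le_rpow_of_exponent_ge (hseq.delta_pos k) (hseq.delta_lt_one hk).le
    ((one_le_div hθ0).2 hθ1.le)

theorem isGreatest_level (hseq : AdmissibleSequences c n a) (hδ : Tendsto (delta c) atTop (𝓝 0))
    (hθ0 : 0 < θ) (hθ1 : θ < 1) {k : ℕ} (hk : 1 ≤ k) :
    IsGreatest (levelSet c θ k) (level c θ k) := by
  obtain ⟨N, hN⟩ :=
    (hδ.eventually_lt_const (Real.rpow_pos_of_pos (hseq.delta_pos k) (1 / θ))).exists
  have hbdd : BddAbove (levelSet c θ k) :=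
    ⟨N, fun l hl => (hseq.delta_strictAnti.lt_iff_gt.1 (hN.trans_le hl.2)).le⟩
  exact ⟨Nat.sSup_mem ⟨k, hseq.self_mem_levelSet hθ0 hθ1 hk⟩ hbdd, fun l hl => le_csSup hbdd hl⟩

theorem delta_level_succ_lt (hseq : AdmissibleSequences c n a)
    (hδ : Tendsto (delta c) atTop (𝓝 0)) (hθ0 : 0 < θ) (hθ1 : θ < 1) {k : ℕ} (hk : 1 ≤ k) :
    delta c (level c θ k + 1) < delta c k ^ (1 / θ) := by
  by_contra! h
  have := (hseq.isGreatest_level hδ hθ0 hθ1 hk).2 ⟨by omega, h⟩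
  omega

end AdmissibleSequences

theorem prod_Icc_mul_prod_Icc (n : ℕ → ℕ) {i j k : ℕ} (hij : i ≤ j) (hjk : j ≤ k) :
    (∏ t ∈ Finset.Icc (i + 1) j, n t) * ∏ t ∈ Finset.Icc (j + 1) k, n t =
      ∏ t ∈ Finset.Icc (i + 1) k, n t := by
  simp only [← Finset.Ico_add_one_right_eq_Icc]
  exact Finset.prod_Ico_consecutive n (by omega) (by omega)

/-! ### Upper and lower covering estimates -/

namespace IsCantorLikeFamily

variable {d : ℕ} {J : Set (EuclideanSpace ℝ (Fin d))} {c : ℕ → ℝ} {n : ℕ → ℕ} {a : ℕ → ℝ}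
  {S : List ℕ → Set (EuclideanSpace ℝ (Fin d))} {A : ℝ} {θ : ℝ}

/-- Group the words by their level-`k` ancestors; these also meet the ball, so packing bounds their
number. -/
theorem card_words_meeting_le (hS : IsCantorLikeFamily J c n a S)
    (hseq : AdmissibleSequences c n a) (hA : PackingBound c n S A) {k j : ℕ} (hkj : k ≤ j)
    (x : EuclideanSpace ℝ (Fin d)) (F : Finset (List ℕ))
    (hF : ∀ τ ∈ F, τ ∈ words n j ∧ (S τ ∩ closedBall x (delta c k)).Nonempty) :
    (F.card : ℝ) ≤ (A * 2) ^ d * (∏ i ∈ Finset.Icc (k + 1) j, n i : ℕ) := by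
  classical
  obtain ⟨q, rfl⟩ := Nat.exists_eq_add_of_le hkj
  have hδ := hseq.delta_pos k
  set G : Finset (List ℕ) := (words_finite n k).toFinset.filter
    fun σ => (S σ ∩ closedBall x (delta c k)).Nonempty with hG
  have hGcard : (G.card : ℝ) ≤ (A * 2) ^ d := by
    have := hA.card_le k x (delta c k) hδ.le G fun σ hσ => by simpa [hG] using hσ
    rwa [div_self hδ.ne', one_add_one_eq_two] at this
  have hsub : F ⊆ G.biUnion fun σ => descendants n k σ q := fun τ hτ => by
    obtain ⟨σ, hσ, hτσ⟩ := exists_mem_descendants (hF τ hτ).1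
    refine Finset.mem_biUnion.2 ⟨σ, ?_, hτσ⟩
    simp only [hG, Finset.mem_filter, Set.Finite.mem_toFinset]
    exact ⟨hσ, (hF τ hτ).2.mono
      (Set.inter_subset_inter_left _ (hS.subset_of_mem_descendants hσ hτσ))⟩
  have hcard := (Finset.card_le_card hsub).trans
    (Finset.card_biUnion_le_card_mul _ _ _ fun σ _ => (card_descendants n k σ q).le)
  calc (F.card : ℝ) ≤ G.card * (∏ i ∈ Finset.Icc (k + 1) (k + q), n i : ℕ) := by exact_mod_cast hcard
    _ ≤ _ := by gcongr

theorem exists_externalCoveringNumber_le (hS : IsCantorLikeFamily J c n a S)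
    (hseq : AdmissibleSequences c n a) (hJ : IsCompact J) (hJne : J.Nonempty)
    (hA : PackingBound c n S A) (hθ0 : 0 < θ) (hθ1 : θ < 1) :
    ∃ K : ℝ, 0 < K ∧ ∀ k, 1 ≤ k → ∀ x,
      (externalCoveringNumber (delta c k ^ (1 / θ)).toNNReal
        (closedBall x (delta c k) ∩ ⋂ k : ℕ, ⋂ _ : 1 ≤ k, ⋃ σ ∈ words n k, S σ) : ℝ≥0∞) ≤
        ENNReal.ofReal (K * (∏ i ∈ Finset.Icc (k + 1) (level c θ k), n i : ℕ)) := by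
  have hδ := hS.tendsto_delta hseq hJ hJne hA
  have hA1 := hA.one_le
  obtain ⟨m, hm0, hm⟩ := hseq.c_inf_pos
  refine ⟨(A * 2) ^ d * (A * (A * (A / m ^ 2) + 1)) ^ d, by positivity, fun k hk x => ?_⟩
  set l := level c θ k
  set r := delta c k ^ (1 / θ) with hr
  have hδk := hseq.delta_pos k
  have hr0 : 0 < r := Real.rpow_pos_of_pos hδk _
  have hr1 : r ≤ 1 := Real.rpow_le_one hδk.le (hseq.delta_lt_one hk).le (by positivity)
  have hl := hseq.isGreatest_level hδ hθ0 hθ1 hk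
  have hkl : k ≤ l := hl.2 (hseq.self_mem_levelSet hθ0 hθ1 hk)
  -- At level `j` each set has diameter at most `r`, so one ball centred in it covers it. Passing
  -- from `l` to `j` costs only a bounded factor, as `δ_l / δ_j` is bounded.
  obtain ⟨j, hj1, hj2⟩ := hseq.exists_delta_between hδ hm (r := r / A) (by positivity)
    ((div_le_one (by positivity)).2 (hr1.trans hA1))
  have hlj : l ≤ j := hseq.delta_strictAnti.le_iff_ge.1
    (hj1.trans ((div_le_self hr0.le hA1).trans hl.1.2))
  have hratio : delta c l / delta c j ≤ A / m ^ 2 := by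
    have h1 := hseq.delta_level_succ_lt hδ hθ0 hθ1 hk
    rw [delta_succ] at h1
    have h2 : delta c l * m ≤ r :=
      (mul_le_mul_of_nonneg_left (hm _ (by omega)) (hseq.delta_pos l).le).trans h1.le
    rw [div_le_div_iff₀ (hseq.delta_pos j) (by positivity)]
    calc delta c l * m ^ 2 = (delta c l * m) * m := by ring
      _ ≤ r * m := by gcongr
      _ = A * (m * (r / A)) := by field_simp
      _ ≤ A * delta c j := by gcongr
  have hlj' : ((∏ i ∈ Finset.Icc (l + 1) j, n i : ℕ) : ℝ) ≤ (A * (A * (A / m ^ 2) + 1)) ^ d := by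
    obtain ⟨q, rfl⟩ := Nat.exists_eq_add_of_le hlj
    refine (hS.prod_le hseq hJ hJne hA l q).trans ?_
    have := hseq.delta_pos l
    have := hseq.delta_pos (l + q)
    rw [mul_div_assoc]
    gcongr
  classical
  set F : Finset (List ℕ) := (words_finite n j).toFinset.filter
    fun τ => (S τ ∩ closedBall x (delta c k)).Nonempty with hF
  have hFcard := hS.card_words_meeting_le hseq hA (hkl.trans hlj) x F fun τ hτ => by
    simpa [hF] using hτ
  choose! y hy using fun τ (hτ : τ ∈ words n j) => hS.nonempty hJne hτ
  have hcov : IsCover r.toNNReal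
      (closedBall x (delta c k) ∩ ⋂ k : ℕ, ⋂ _ : 1 ≤ k, ⋃ σ ∈ words n k, S σ)
      (F.image y : Set (EuclideanSpace ℝ (Fin d))) := by
    rw [isCover_iff_subset_iUnion_closedBall, Real.coe_toNNReal _ hr0.le]
    rintro z ⟨hz, hzE⟩
    simp only [Set.mem_iInter, Set.mem_iUnion] at hzE
    obtain ⟨τ, hτ, hzτ⟩ := hzE j (by omega)
    have hτF : τ ∈ F := by
      simp only [hF, Finset.mem_filter, Set.Finite.mem_toFinset]
      exact ⟨hτ, z, hzτ, hz⟩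
    refine Set.mem_biUnion (Finset.mem_coe.2 (Finset.mem_image_of_mem y hτF)) ?_
    refine closedBall_subset_closedBall ?_ (hS.subset_closedBall hJ hA hτ (hy τ hτ) hzτ)
    rwa [mul_comm, ← le_div_iff₀ (by positivity)]
  have h1 : externalCoveringNumber r.toNNReal
      (closedBall x (delta c k) ∩ ⋂ k : ℕ, ⋂ _ : 1 ≤ k, ⋃ σ ∈ words n k, S σ) ≤ (F.card : ℕ∞) := by
    refine hcov.externalCoveringNumber_le_encard.trans ?_
    rw [Set.encard_coe_eq_coe_finsetCard]
    exact_mod_cast Finset.card_image_le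
  calc _ ≤ (((F.card : ℕ) : ℕ∞) : ℝ≥0∞) := by exact_mod_cast h1
    _ = ENNReal.ofReal F.card := by simp
    _ ≤ _ := ENNReal.ofReal_le_ofReal ?_
  rw [← prod_Icc_mul_prod_Icc n hkl hlj] at hFcard
  calc (F.card : ℝ) ≤ _ := hFcard
    _ = (A * 2) ^ d * (∏ i ∈ Finset.Icc (l + 1) j, n i : ℕ) *
        (∏ i ∈ Finset.Icc (k + 1) l, n i : ℕ) := by push_cast; ring
    _ ≤ _ := by gcongr

theorem exists_prod_le_externalCoveringNumber (hS : IsCantorLikeFamily J c n a S)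
    (hseq : AdmissibleSequences c n a) (hJ : IsCompact J) (hJne : J.Nonempty)
    (hA : PackingBound c n S A) (hθ0 : 0 < θ) (hθ1 : θ < 1) :
    ∃ K : ℝ, 0 < K ∧ ∀ k₀ : ℕ, ∃ b : ℝ, 0 < b ∧ ∀ R : ℝ, 0 < R → R < b →
      ∃ k, k₀ ≤ k ∧ delta c k ≤ R ∧
        ∀ x ∈ ⋂ k : ℕ, ⋂ _ : 1 ≤ k, ⋃ σ ∈ words n k, S σ,
          ENNReal.ofReal (K * (∏ i ∈ Finset.Icc (k + 1) (level c θ k), n i : ℕ)) ≤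
            (externalCoveringNumber (R ^ (1 / θ)).toNNReal
              (closedBall x R ∩ ⋂ k : ℕ, ⋂ _ : 1 ≤ k, ⋃ σ ∈ words n k, S σ) : ℝ≥0∞) := by
  have hδ := hS.tendsto_delta hseq hJ hJne hA
  have hA1 := hA.one_le
  obtain ⟨m, hm0, hm⟩ := hseq.c_inf_pos
  -- `M` bounds how many sets of level `l(θ,k)` can meet one covering ball.
  set M : ℝ := (A * ((A / m) ^ (1 / θ) + 1)) ^ d with hM
  have hM0 : 0 < M := by positivity
  refine ⟨M⁻¹, by positivity, fun k₀ => ⟨delta c k₀, hseq.delta_pos k₀, fun R hR hRb => ?_⟩⟩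
  have hR1 : R ≤ 1 := hRb.le.trans (delta_zero c ▸ hseq.delta_strictAnti.antitone (Nat.zero_le k₀))
  obtain ⟨k, hk1, hk2⟩ := hseq.exists_delta_between hδ hm (r := R / A) (by positivity)
    ((div_le_one (by positivity)).2 (hR1.trans hA1))
  have hkR : delta c k ≤ R := hk1.trans (div_le_self hR.le hA1)
  have hk₀ : k₀ < k := hseq.delta_strictAnti.lt_iff_gt.1 (hkR.trans_lt hRb)
  have hk : 1 ≤ k := by omega
  have hδk := hseq.delta_pos k
  refine ⟨k, hk₀.le, hkR, fun x hx => ofReal_le_externalCoveringNumber fun C hC => ?_⟩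
  have hl := hseq.isGreatest_level hδ hθ0 hθ1 hk
  have hkl : k ≤ level c θ k := hl.2 (hseq.self_mem_levelSet hθ0 hθ1 hk)
  have hlδ := hl.1.2
  obtain ⟨q, hq⟩ := Nat.exists_eq_add_of_le hkl
  rw [hq] at hlδ ⊢
  have hδl := hseq.delta_pos (k + q)
  set r := R ^ (1 / θ) with hr
  have hr0 : 0 < r := Real.rpow_pos_of_pos hR _
  have hrl : r / delta c (k + q) ≤ (A / m) ^ (1 / θ) := by
    rw [div_le_iff₀ hδl]
    calc r ≤ (A / m * delta c k) ^ (1 / θ) := by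
          refine Real.rpow_le_rpow hR.le ?_ (by positivity)
          rw [div_mul_eq_mul_div, le_div_iff₀ hm0]
          calc R * m = A * (m * (R / A)) := by field_simp
            _ ≤ _ := by gcongr
      _ = (A / m) ^ (1 / θ) * delta c k ^ (1 / θ) := Real.mul_rpow (by positivity) hδk.le
      _ ≤ _ := by gcongr
  have hxE := hx
  simp only [Set.mem_iInter, Set.mem_iUnion] at hx
  obtain ⟨σ, hσ, hxσ⟩ := hx k hk
  rw [Real.coe_toNNReal _ hr0.le] at hC
  have hball : S σ ⊆ closedBall x R := (hS.subset_closedBall hJ hA hσ hxσ).trans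
    (closedBall_subset_closedBall (by rwa [mul_comm, ← le_div_iff₀ (by positivity)]))
  -- Every descendant contains a point of `E`, so it meets some covering ball; counting descendants
  -- ball by ball bounds the size of `C` below.
  have hcentre : ∀ τ ∈ descendants n k σ q, ∃ p ∈ C, (S τ ∩ closedBall p r).Nonempty := by
    intro τ hτ
    obtain ⟨z, hzτ, hzE⟩ := hS.exists_mem_inter (fun k hk => by
      have := hseq.two_le_n k hk; omega) hJ hJne (mem_words_of_mem_descendants hσ hτ)
    have := hC ⟨hball (hS.subset_of_mem_descendants hσ hτ hzτ), hzE⟩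
    simp only [Set.mem_iUnion] at this
    obtain ⟨p, hp, hzp⟩ := this
    exact ⟨p, hp, z, hzτ, hzp⟩
  choose! p hpC hp using hcentre
  classical
  rw [← card_descendants n k σ q, inv_mul_le_iff₀ hM0,
    Finset.card_eq_sum_card_fiberwise (f := p) (t := C) hpC, mul_comm, Nat.cast_sum,
    ← nsmul_eq_mul]
  refine Finset.sum_le_card_nsmul _ _ _ fun y _ => ?_
  refine (hA.card_le (k + q) y r hr0.le _ fun τ hτ => ?_).trans ?_
  · rw [Finset.mem_filter] at hτ
    exact ⟨mem_words_of_mem_descendants hσ hτ.1, hτ.2 ▸ hp τ hτ.1⟩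
  · rw [hM]
    gcongr

end IsCantorLikeFamily

/-! ### From covering estimates to the lower spectrum -/

theorem one_le_prod_Icc {n : ℕ → ℕ} (hn : ∀ k, 1 ≤ k → 2 ≤ n k) (k l : ℕ) :
    1 ≤ ∏ i ∈ Finset.Icc (k + 1) l, (n i : ℝ) := by
  have h : 1 ≤ ∏ i ∈ Finset.Icc (k + 1) l, n i := Finset.one_le_prod' fun i hi => by
    have := hn i (by simp at hi; omega)
    omega
  exact_mod_cast h

theorem div_rpow_rpow_eq_exp {δ θ s : ℝ} (hδ : 0 < δ) :
    (δ / δ ^ (1 / θ)) ^ s = Real.exp (s * ((1 - 1 / θ) * Real.log δ)) := by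
  rw [Real.rpow_def_of_pos (by positivity), Real.log_div hδ.ne' (by positivity),
    Real.log_rpow hδ]
  ring_nf

theorem tendsto_one_sub_mul_log {δ : ℕ → ℝ} (hpos : ∀ k, 0 < δ k)
    (hδ : Tendsto δ atTop (𝓝 0)) {θ : ℝ} (hθ0 : 0 < θ) (hθ1 : θ < 1) :
    Tendsto (fun k => (1 - 1 / θ) * Real.log (δ k)) atTop atTop := by
  refine Tendsto.const_mul_atBot_of_neg (sub_neg.2 ((one_lt_div hθ0).2 hθ1)) ?_
  exact Real.tendsto_log_nhdsGT_zero.comp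
    (tendsto_nhdsWithin_iff.2 ⟨hδ, Eventually.of_forall hpos⟩)

theorem lowerSpectrum_le_liminf {X : Type*} [PseudoMetricSpace X] {E : Set X} (hE : E.Nonempty)
    {θ : ℝ} (hθ0 : 0 < θ) (hθ1 : θ < 1) {δ P : ℕ → ℝ} (hpos : ∀ k, 0 < δ k)
    (hδ : Tendsto δ atTop (𝓝 0)) (hP : ∀ k, 1 ≤ P k) {K : ℝ} (hK : 0 < K)
    (hcov : ∀ k, 1 ≤ k → ∀ x ∈ E, (Metric.externalCoveringNumber (δ k ^ (1 / θ)).toNNReal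
      (Metric.closedBall x (δ k) ∩ E) : ℝ≥0∞) ≤ ENNReal.ofReal (K * P k)) :
    lowerSpectrum θ E ≤ liminf (fun k : ℕ =>
      ((Real.log (P k) / ((1 - 1 / θ) * Real.log (δ k)) : ℝ) : EReal)) atTop := by
  refine sSup_le ?_
  rintro t ⟨s, rfl, -, b, hb, C, hC, h⟩
  refine EReal.ge_of_forall_gt_iff_ge.1 fun s' hs' => ?_
  obtain ⟨x, hx⟩ := hE
  have hL := tendsto_one_sub_mul_log hpos hδ hθ0 hθ1
  refine le_liminf_of_le (by isBoundedDefault) ?_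
  filter_upwards [eventually_ge_atTop 1, hδ.eventually_lt_const hb, hL.eventually_gt_atTop 0,
    -- Beyond this threshold the gap `s - s'` absorbs the constants `K` and `C`.
    hL.eventually_ge_atTop ((Real.log K - Real.log C) / (s - s'))] with k hk1 hkb hk0 hkL
  rw [EReal.coe_le_coe_iff, le_div_iff₀ hk0]
  have hss : 0 < s - s' := sub_pos.2 (EReal.coe_lt_coe_iff.1 hs')
  have h1 := (h (δ k) (hpos k) hkb x hx).trans (hcov k hk1 x hx)
  have hPk := one_pos.trans_le (hP k)
  rw [ENNReal.ofReal_le_ofReal_iff (by positivity), div_rpow_rpow_eq_exp (hpos k)] at h1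
  have h2 := Real.log_le_log (by positivity) h1
  rw [Real.log_mul hC.ne' (Real.exp_ne_zero _), Real.log_exp, Real.log_mul hK.ne' hPk.ne'] at h2
  rw [div_le_iff₀ hss] at hkL
  linarith

theorem liminf_le_lowerSpectrum {X : Type*} [PseudoMetricSpace X] {E : Set X}
    {θ : ℝ} (hθ0 : 0 < θ) (hθ1 : θ < 1) {δ P : ℕ → ℝ} (hpos : ∀ k, 0 < δ k)
    (hδ : Tendsto δ atTop (𝓝 0)) (hP : ∀ k, 1 ≤ P k) {K : ℝ} (hK : 0 < K)
    (hcov : ∀ k₀ : ℕ, ∃ b : ℝ, 0 < b ∧ ∀ R : ℝ, 0 < R → R < b → ∃ k, k₀ ≤ k ∧ δ k ≤ R ∧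
      ∀ x ∈ E, ENNReal.ofReal (K * P k) ≤ (Metric.externalCoveringNumber (R ^ (1 / θ)).toNNReal
        (Metric.closedBall x R ∩ E) : ℝ≥0∞)) :
    liminf (fun k : ℕ =>
      ((Real.log (P k) / ((1 - 1 / θ) * Real.log (δ k)) : ℝ) : EReal)) atTop ≤
      lowerSpectrum θ E := by
  refine EReal.ge_of_forall_gt_iff_ge.1 fun s hs => ?_
  have hs1 := eventually_lt_of_lt_liminf hs
  have hL := tendsto_one_sub_mul_log hpos hδ hθ0 hθ1
  obtain ⟨k₀, hk₀⟩ := eventually_atTop.1 (hs1.and (hL.eventually_gt_atTop 0))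
  obtain ⟨b, hb, hcov⟩ := hcov k₀
  -- The spectrum admits only nonnegative exponents; replacing `s` by `max s 0` is harmless, as the
  -- quotients are nonnegative.
  refine le_trans (EReal.coe_le_coe_iff.2 (le_max_left s 0)) (le_sSup ⟨max s 0, rfl,
    le_max_right _ _, b, hb, K, hK, fun R hR hRb x hx => ?_⟩)
  obtain ⟨k, hk, hkR, hcov⟩ := hcov R hR hRb
  refine le_trans (ENNReal.ofReal_le_ofReal ?_) (hcov x hx)
  obtain ⟨hsk, hLk⟩ := hk₀ k hk
  rw [EReal.coe_lt_coe_iff] at hsk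
  have hPk := one_pos.trans_le (hP k)
  have h1 : max s 0 ≤ Real.log (P k) / ((1 - 1 / θ) * Real.log (δ k)) :=
    max_le hsk.le (div_nonneg (Real.log_nonneg (hP k)) hLk.le)
  rw [le_div_iff₀ hLk] at h1
  have hlog : Real.log (δ k) ≤ Real.log R := Real.log_le_log (hpos k) hkR
  have hθ : 1 - 1 / θ ≤ 0 := (sub_neg.2 ((one_lt_div hθ0).2 hθ1)).le
  rw [div_rpow_rpow_eq_exp hR]
  gcongr
  rw [← Real.le_log_iff_exp_le hPk]
  -- Since `1 - 1/θ` is negative, `δ k ≤ R` is the direction needed to replace `R` by `δ k`.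
  exact (mul_le_mul_of_nonneg_left (mul_le_mul_of_nonpos_left hlog hθ) (le_max_right s 0)).trans h1

end CantorLike

theorem theorem3p4 {d : ℕ} (hd : 1 ≤ d)
    (J : Set (EuclideanSpace ℝ (Fin d))) (hJclosed : IsClosed J)
    (hJbdd : Bornology.IsBounded J) (hJint : (interior J).Nonempty)
    (c : ℕ → ℝ) (n : ℕ → ℕ) (a : ℕ → ℝ) (hseq : CantorLike.AdmissibleSequences c n a)
    (E : Set (EuclideanSpace ℝ (Fin d))) (hE : E ∈ CantorLike.cantorLikeSets J c n a)
    (θ : ℝ) (hθ0 : 0 < θ) (hθ1 : θ < 1) :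
    (∀ k : ℕ, 1 ≤ k → IsGreatest (CantorLike.levelSet c θ k) (CantorLike.level c θ k)) ∧
    CantorLike.lowerSpectrum θ E =
      Filter.liminf (fun k : ℕ =>
        ((Real.log (∏ i ∈ Finset.Icc (k + 1) (CantorLike.level c θ k), (n i : ℝ)) /
          ((1 - 1 / θ) * Real.log (CantorLike.delta c k)) : ℝ) : EReal)) Filter.atTop := by
  obtain ⟨S, hS, rfl⟩ := hE
  have hJ : IsCompact J := Metric.isCompact_of_isClosed_isBounded hJclosed hJbdd
  have hJne : J.Nonempty := hJint.mono interior_subset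
  have hdiam := CantorLike.IsCantorLikeFamily.diam_pos hd hJbdd hJint
  obtain ⟨A, hA⟩ := hS.exists_packingBound hseq hJ hdiam hJint
  have hδ := hS.tendsto_delta hseq hJ hJne hA
  obtain ⟨K₁, hK₁, h₁⟩ := hS.exists_externalCoveringNumber_le hseq hJ hJne hA hθ0 hθ1
  obtain ⟨K₂, hK₂, h₂⟩ := hS.exists_prod_le_externalCoveringNumber hseq hJ hJne hA hθ0 hθ1
  have hP := fun k => CantorLike.one_le_prod_Icc hseq.two_le_n k (CantorLike.level c θ k)
  simp only [Nat.cast_prod] at h₁ h₂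
  refine ⟨fun k hk => hseq.isGreatest_level hδ hθ0 hθ1 hk, le_antisymm ?_ ?_⟩
  · refine CantorLike.lowerSpectrum_le_liminf ?_ hθ0 hθ1 hseq.delta_pos hδ hP hK₁
      fun k hk x _ => h₁ k hk x
    exact (hS.exists_mem_inter (fun k hk => one_le_two.trans (hseq.two_le_n k hk)) hJ hJne
      (k := 0) (σ := []) (by simp [CantorLike.words_zero])).mono Set.inter_subset_right
  · exact CantorLike.liminf_le_lowerSpectrum hθ0 hθ1 hseq.delta_pos hδ hP hK₂ h₂
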